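/- Let $k$ be a field and $S=k[x_1,\dots,x_n]$ with its natural $\mathbb{Z}^n$-grading. For a monomial ideal $I\subseteq S$ let $$\cdots\to F_1\to F_0\to I\to 0,\qquad F_i=\bigoplus_{\mathbf a}S(\mathbf x^{\mathbf a})^{\beta_{i,\mathbf a}},$$ be its minimal multigraded free resolution, where $S(\mathbf x^{\mathbf a})$ denotes the free $S$-module with one generator of multidegree $\mathbf a$. The $i$th homological shift ideal of $I$ is $\mathrm{HS}_i(I)=(\{\mathbf x^{\mathbf a} : \beta_{i,\mathbf a}\neq 0\})$. A monomial ideal $I\subseteq S$ is called squarefree Borel if it is generated by squarefree monomials and, for every squarefree monomial $u\in I$ and all $i<j$ such that $x_j$ divides $u$ and $(u/x_j)x_i$ is squarefree, one has $(u/x_j)x_i\in I$. **Theorem 1.9.** Let $I\subseteq S$ be a squarefree Borel ideal (not necessarily generated in a single degree). Then $$\mathrm{HS}_{i+j}(I)=\mathrm{HS}_i(\mathrm{HS}_j(I))\qquad\text{for all integers } i,j\ge 0.$$ -/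

import Mathlib

/-!
`S = k[x_1, …, x_n]` is `MvPolynomial (Fin n) k`. The monomial `x^a` is `MvPolynomial.monomial a 1`
with `a : Fin n →₀ ℕ`, and monomials are identified with their multidegrees.
-/

namespace HomShift

open MvPolynomial

variable {k : Type*} [Field k] {n : ℕ}

/-- Let `⨁_b S(x^{deg b})` be the free module whose basis vector `e_b` has multidegree `deg b`.
The element `f` is multihomogeneous of multidegree `d` when every term of every coordinate
`f b` has multidegree `d` after adding the multidegree of `e_b` (in particular `0` is
multihomogeneous of every multidegree). -/
def IsMultihomogeneous {ι : Type*} (deg : ι → (Fin n →₀ ℕ)) (d : Fin n →₀ ℕ)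
    (f : ι →₀ MvPolynomial (Fin n) k) : Prop :=
  ∀ b, ∀ m ∈ (f b).support, m + deg b = d

/-- A minimal multigraded free resolution `⋯ → F_1 → F_0 → I → 0` of the ideal `I ⊆ S`
by finitely generated multigraded free modules `F_i = ⨁_{b ∈ ι i} S(x^{deg i b})`.
All maps preserve multidegrees, the augmented complex is exact, and minimality is expressed by
`d(F_{i+1}) ⊆ (x_1, …, x_n) F_i`. Multidegrees of basis elements lie in `ℕ^n`, since
a multigraded minimal resolution of a submodule of `S` has no others; likewise finite length is
automatic for minimal resolutions over `S`, and is not imposed separately. -/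
structure MinimalResolution (I : Ideal (MvPolynomial (Fin n) k)) where
  /-- the index set of the homogeneous basis of `F_i` -/
  ι : ℕ → Type
  finite : ∀ i, Finite (ι i)
  /-- the multidegrees of the basis elements of `F_i` -/
  deg : ∀ i, ι i → (Fin n →₀ ℕ)
  /-- the augmentation `F_0 → I ⊆ S` -/
  aug : (ι 0 →₀ MvPolynomial (Fin n) k) →ₗ[MvPolynomial (Fin n) k] MvPolynomial (Fin n) k
  /-- the differentials `F_{i+1} → F_i` -/
  d : ∀ i, (ι (i + 1) →₀ MvPolynomial (Fin n) k) →ₗ[MvPolynomial (Fin n) k]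
    (ι i →₀ MvPolynomial (Fin n) k)
  aug_homogeneous : ∀ b, ∀ m ∈ (aug (Finsupp.single b 1)).support, m = deg 0 b
  d_homogeneous : ∀ i b, IsMultihomogeneous (deg i) (deg (i + 1) b) (d i (Finsupp.single b 1))
  range_aug : LinearMap.range aug = I
  exact_zero : Function.Exact (d 0) aug
  exact_succ : ∀ i, Function.Exact (d (i + 1)) (d i)
  minimal : ∀ i, LinearMap.range (d i) ≤
    (idealOfVars (Fin n) k • ⊤ :
      Submodule (MvPolynomial (Fin n) k) (ι i →₀ MvPolynomial (Fin n) k))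

/-- The multigraded Betti number `β_{i,a}`: the number of summands `S(x^a)` of `F_i`. -/
noncomputable def MinimalResolution.betti {I : Ideal (MvPolynomial (Fin n) k)}
    (F : MinimalResolution I) (i : ℕ) (a : Fin n →₀ ℕ) : ℕ :=
  Nat.card {b : F.ι i // F.deg i b = a}

/-- The `i`th homological shift ideal `HS_i(I) = ({x^a | β_{i,a} ≠ 0})`, with the Betti numbers read
off a minimal multigraded free resolution of `I`, which is unique up to isomorphism. -/
noncomputable def HS (i : ℕ) (I : Ideal (MvPolynomial (Fin n) k)) : Ideal (MvPolynomial (Fin n) k) :=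
  Ideal.span {f | ∃ (F : MinimalResolution I) (a : Fin n →₀ ℕ),
    F.betti i a ≠ 0 ∧ f = monomial a 1}

/-- The monomial `x^a` is squarefree. -/
def IsSquarefreeExponent (a : Fin n →₀ ℕ) : Prop := ∀ t, a t ≤ 1

/-- `I` is a squarefree monomial ideal: it is generated by squarefree monomials. -/
def IsSquarefreeMonomialIdeal (I : Ideal (MvPolynomial (Fin n) k)) : Prop :=
  ∃ A : Set (Fin n →₀ ℕ), (∀ a ∈ A, IsSquarefreeExponent a) ∧
    I = Ideal.span ((fun a => monomial a (1 : k)) '' A)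

/-- The exponent of `(x^a / x_j) x_i`; used only when `x_j` divides `x^a`. -/
noncomputable def borelMove (a : Fin n →₀ ℕ) (j i : Fin n) : Fin n →₀ ℕ :=
  a - Finsupp.single j 1 + Finsupp.single i 1

/-- `I` is a squarefree Borel ideal: a squarefree monomial ideal that is closed under squarefree
Borel moves, which send a squarefree monomial `u` to `(u / x_j) x_i`, where `x_j` divides `u`,
`i < j`, and `(u / x_j) x_i` is squarefree. -/
def IsSquarefreeBorel (I : Ideal (MvPolynomial (Fin n) k)) : Prop :=
  IsSquarefreeMonomialIdeal I ∧
    ∀ (a : Fin n →₀ ℕ) (j i : Fin n), monomial a (1 : k) ∈ I → IsSquarefreeExponent a →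
      a j ≠ 0 → i < j → IsSquarefreeExponent (borelMove a j i) →
        monomial (borelMove a j i) (1 : k) ∈ I

end HomShift

/-!
The multidegrees in the minimal resolution of a squarefree Borel ideal are found explicitly, after
which the theorem is a statement about families of subsets of `{1, …, n}`.

*Minimal resolutions.* It is convenient to resolve `S/I` instead of `I` (`QuotientResolution`), so
that all differentials have the same shape. Graded maps between ideals lift to resolutions
(`exists_comparison`), and a chain endomorphism of a minimal resolution lifting `0` vanishes modulo
the variables (`isMinimalMap_of_chain`). Hence the multidegrees of a minimal resolution depend
only on the ideal, and a single resolution computes `HS` (`HS_eq_span`).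

*The resolution.* Adjoining a monomial `x^u` to an ideal `I`, the mapping cone of a lift of
`x^u : S/(I : x^u) → S/I` resolves `S/(I + (x^u))` (`exists_cone`). Starting from `0` this gives the
Koszul resolution of a set of variables (`exists_koszul`), and then the resolution of an ideal with
linear quotients. In the order by degree and then colexicographically, the generators of a
squarefree stable ideal have linear quotients: the colon ideal at a generator `u` is generated by
the variables `x_s` with `s ∉ u` and `s < max u`, the gaps of `u` (`IsStable.colon_iff`). In positive
homological degree all entries of the lift are nonunits, because a basis vector of the shifted
Koszul resolution has larger total degree than the basis vectors it maps to. So the `j`th step has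
basis vectors in the multidegrees `u ∪ σ`, where `u` is a generator and `σ` a set of `j` gaps of `u`
(`IsStable.exists_resolution`).

*Combinatorics.* The homological shifts of a squarefree Borel ideal need not be Borel: for
`I = (x_1, x_2 x_3, x_2 x_4)`, the ideal `HS_1(I)` contains `x_2 x_3 x_4` but not `x_1 x_3 x_4`.
They are squarefree stable, though, that is, closed under moves of the *largest* variable of a
monomial (`IsStable.shift`), and stability suffices for the resolution. So the formula for the
multidegrees applies to `HS_j(I)` as well, and the theorem reduces to `shiftUp_shiftUp`.
One inclusion is clear. For the other, given a generator `u` with a set `ρ` of `i + j` gaps, let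
`σ` be the `j` largest elements of `ρ`: a generator of `HS_j(I)` dividing `x^(u ∪ σ)` still has
all of `ρ \ σ` as gaps.
-/

open MvPolynomial

namespace HomShift

variable {k : Type*} [Field k] {n : ℕ} {ι κ κ' : Type*}

local notation "𝕊" => MvPolynomial (Fin n) k

/-! ### Multigraded free modules -/

/-- A map of multigraded free modules that raises multidegrees by `u`; equivalently, a degree
preserving map from the source shifted by `u`. -/
def IsGradedMap (deg : ι → (Fin n →₀ ℕ)) (deg' : κ → (Fin n →₀ ℕ)) (u : Fin n →₀ ℕ)
    (φ : (ι →₀ MvPolynomial (Fin n) k) →ₗ[MvPolynomial (Fin n) k]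
      (κ →₀ MvPolynomial (Fin n) k)) : Prop :=
  ∀ b, IsMultihomogeneous deg' (deg b + u) (φ (Finsupp.single b 1))

/-- The multihomogeneous component of multidegree `e` of an element of a free module. -/
noncomputable def component (deg : ι → (Fin n →₀ ℕ)) (e : Fin n →₀ ℕ) :
    (ι →₀ MvPolynomial (Fin n) k) →+ (ι →₀ MvPolynomial (Fin n) k) :=
  open Classical in
  Finsupp.liftAddHom fun b => (Finsupp.singleAddHom b).comp
    (if deg b ≤ e then (monomial (e - deg b)).toAddMonoidHom.comp (coeffAddMonoidHom (e - deg b))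
      else 0)

theorem isMultihomogeneous_iff_coeff {deg : ι → (Fin n →₀ ℕ)} {e : Fin n →₀ ℕ} {f : ι →₀ 𝕊} :
    IsMultihomogeneous deg e f ↔ ∀ b m, coeff m (f b) ≠ 0 → m + deg b = e := by
  simp [IsMultihomogeneous, mem_support_iff]

open Classical in
theorem coeff_component (deg : ι → (Fin n →₀ ℕ)) (e : Fin n →₀ ℕ) (f : ι →₀ 𝕊) (b : ι)
    (m : Fin n →₀ ℕ) :
    coeff m (component deg e f b) = if m + deg b = e then coeff m (f b) else 0 := by
  induction f using Finsupp.induction_linear with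
  | zero => simp
  | add f g hf hg => simp only [map_add, Finsupp.add_apply, coeff_add, hf, hg]; split_ifs <;> simp
  | single c p =>
    simp only [component, Finsupp.liftAddHom_apply_single, AddMonoidHom.comp_apply,
      Finsupp.singleAddHom_apply]
    by_cases hc : c = b
    · subst hc
      by_cases h : deg c ≤ e
      · have h1 : m + deg c = e ↔ e - deg c = m := by
          constructor
          · rintro rfl; simp
          · rintro rfl; exact tsub_add_cancel_of_le h
        simp only [h, if_true, AddMonoidHom.comp_apply, Finsupp.single_eq_same, h1]
        simp only [LinearMap.toAddMonoidHom_coe, coeff_monomial, coeffAddMonoidHom_apply]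
        split_ifs with h2
        · rw [h2]
        · rfl
      · have h1 : ¬ (m + deg c = e) := by
          rintro rfl; exact h le_add_self
        simp [h, h1]
    · simp [hc]

theorem isMultihomogeneous_component (deg : ι → (Fin n →₀ ℕ)) (e : Fin n →₀ ℕ) (f : ι →₀ 𝕊) :
    IsMultihomogeneous deg e (component deg e f) := by
  classical
  rw [isMultihomogeneous_iff_coeff]
  intro b m h
  rw [coeff_component] at h
  by_contra h2
  simp [h2] at h

theorem IsMultihomogeneous.component_eq {deg : ι → (Fin n →₀ ℕ)} {e : Fin n →₀ ℕ} {f : ι →₀ 𝕊}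
    (hf : IsMultihomogeneous deg e f) : component deg e f = f := by
  classical
  rw [isMultihomogeneous_iff_coeff] at hf
  ext b m
  rw [coeff_component]
  split_ifs with h
  · rfl
  · by_contra h2; exact h (hf b m (Ne.symm h2))

theorem IsMultihomogeneous.component_of_ne {deg : ι → (Fin n →₀ ℕ)} {e e' : Fin n →₀ ℕ}
    {f : ι →₀ 𝕊} (hf : IsMultihomogeneous deg e f) (hne : e ≠ e') :
    component deg e' f = 0 := by
  classical
  rw [isMultihomogeneous_iff_coeff] at hf
  ext b m
  rw [coeff_component]
  split_ifs with h
  · by_contra h2; exact hne ((hf b m h2).symm.trans h)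
  · rfl

theorem IsMultihomogeneous.monomial_smul {deg : ι → (Fin n →₀ ℕ)} {e : Fin n →₀ ℕ} {f : ι →₀ 𝕊}
    (hf : IsMultihomogeneous deg e f) (m : Fin n →₀ ℕ) (r : k) :
    IsMultihomogeneous deg (m + e) (monomial m r • f) := by
  rw [isMultihomogeneous_iff_coeff] at hf ⊢
  intro b m' h
  rw [Finsupp.smul_apply, smul_eq_mul, coeff_monomial_mul'] at h
  split_ifs at h with h1
  · have := hf b _ (right_ne_zero_of_mul h)
    rw [← this, ← add_assoc, add_tsub_cancel_of_le h1]
  · exact absurd rfl h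

theorem IsMultihomogeneous.add {deg : ι → (Fin n →₀ ℕ)} {e : Fin n →₀ ℕ} {f g : ι →₀ 𝕊}
    (hf : IsMultihomogeneous deg e f) (hg : IsMultihomogeneous deg e g) :
    IsMultihomogeneous deg e (f + g) := by
  rw [isMultihomogeneous_iff_coeff] at hf hg ⊢
  intro b m h
  by_cases h1 : coeff m (f b) = 0
  · exact hg b m (by simpa [h1] using h)
  · exact hf b m h1

theorem isMultihomogeneous_zero (deg : ι → (Fin n →₀ ℕ)) (e : Fin n →₀ ℕ) :
    IsMultihomogeneous deg e (0 : ι →₀ 𝕊) := by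
  simp [IsMultihomogeneous]

theorem isMultihomogeneous_single (deg : ι → (Fin n →₀ ℕ)) (b : ι) (m : Fin n →₀ ℕ) (r : k) :
    IsMultihomogeneous deg (m + deg b) (Finsupp.single b (monomial m r)) := by
  classical
  rw [isMultihomogeneous_iff_coeff]
  intro c m' h
  rw [Finsupp.single_apply] at h
  split_ifs at h with hc
  · rw [coeff_monomial] at h
    split_ifs at h with hm
    · rw [hm, hc]
    · exact absurd rfl h
  · simp at h

theorem IsMultihomogeneous.sum {α : Type*} {deg : ι → (Fin n →₀ ℕ)} {e : Fin n →₀ ℕ}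
    {s : Finset α} {f : α → ι →₀ 𝕊} (hf : ∀ a ∈ s, IsMultihomogeneous deg e (f a)) :
    IsMultihomogeneous deg e (∑ a ∈ s, f a) :=
  Finset.sum_induction _ (IsMultihomogeneous deg e) (fun _ _ => .add)
    (isMultihomogeneous_zero _ _) hf

theorem sum_smul_single (x : ι →₀ 𝕊) :
    ∑ b ∈ x.support, x b • Finsupp.single b (1 : 𝕊) = x := by
  simpa [Finsupp.sum] using x.sum_single

theorem IsGradedMap.map_isMultihomogeneous {deg : ι → (Fin n →₀ ℕ)} {deg' : κ → (Fin n →₀ ℕ)}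
    {u e : Fin n →₀ ℕ} {φ : (ι →₀ 𝕊) →ₗ[𝕊] (κ →₀ 𝕊)} (hφ : IsGradedMap deg deg' u φ)
    {x : ι →₀ 𝕊} (hx : IsMultihomogeneous deg e x) : IsMultihomogeneous deg' (e + u) (φ x) := by
  rw [isMultihomogeneous_iff_coeff] at hx
  rw [← sum_smul_single x, map_sum]
  refine .sum fun c _ => ?_
  rw [map_smul, (x c).as_sum, Finset.sum_smul]
  refine .sum fun m hm => ?_
  rw [← hx c m (mem_support_iff.1 hm), add_assoc]
  exact (hφ c).monomial_smul _ _

theorem IsGradedMap.comp {deg : ι → (Fin n →₀ ℕ)} {deg' : κ → (Fin n →₀ ℕ)}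
    {deg'' : κ' → (Fin n →₀ ℕ)} {u v : Fin n →₀ ℕ} {φ : (κ →₀ 𝕊) →ₗ[𝕊] (κ' →₀ 𝕊)}
    {ψ : (ι →₀ 𝕊) →ₗ[𝕊] (κ →₀ 𝕊)} (hφ : IsGradedMap deg' deg'' u φ)
    (hψ : IsGradedMap deg deg' v ψ) : IsGradedMap deg deg'' (v + u) (φ ∘ₗ ψ) := by
  intro b
  rw [← add_assoc]
  exact hφ.map_isMultihomogeneous (hψ b)

/-- Graded maps commute with taking components. -/
theorem IsGradedMap.map_component {deg : ι → (Fin n →₀ ℕ)} {deg' : κ → (Fin n →₀ ℕ)}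
    {φ : (ι →₀ 𝕊) →ₗ[𝕊] (κ →₀ 𝕊)} (hφ : IsGradedMap deg deg' 0 φ) (e : Fin n →₀ ℕ) (x : ι →₀ 𝕊) :
    φ (component deg e x) = component deg' e (φ x) := by
  induction x using Finsupp.induction_linear with
  | zero => simp
  | add f g hf hg => simp [hf, hg]
  | single b p =>
    induction p using MvPolynomial.induction_on' with
    | add p q hp hq => rw [Finsupp.single_add]; simp only [map_add, hp, hq]
    | monomial m r =>
      have h1 := isMultihomogeneous_single (k := k) deg b m r
      have h2 : IsMultihomogeneous deg' (m + deg b) (φ (Finsupp.single b (monomial m r))) := by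
        simpa using hφ.map_isMultihomogeneous h1
      by_cases h : m + deg b = e
      · subst h
        rw [h1.component_eq, h2.component_eq]
      · rw [h1.component_of_ne h, h2.component_of_ne h, map_zero]

/-- Free modules are graded projective: a graded map into the image of a graded map lifts. -/
theorem IsGradedMap.exists_lift {deg : ι → (Fin n →₀ ℕ)} {deg' : κ → (Fin n →₀ ℕ)}
    {deg'' : κ' → (Fin n →₀ ℕ)} {u : Fin n →₀ ℕ}
    {φ : (ι →₀ 𝕊) →ₗ[𝕊] (κ →₀ 𝕊)} {d : (κ' →₀ 𝕊) →ₗ[𝕊] (κ →₀ 𝕊)}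
    (hφ : IsGradedMap deg deg' u φ) (hd : IsGradedMap deg'' deg' 0 d)
    (h : ∀ x, φ x ∈ LinearMap.range d) :
    ∃ ψ : (ι →₀ 𝕊) →ₗ[𝕊] (κ' →₀ 𝕊), IsGradedMap deg deg'' u ψ ∧ ∀ x, d (ψ x) = φ x := by
  choose g hg using fun b => h (Finsupp.single b 1)
  refine ⟨Finsupp.linearCombination _ fun b => component deg'' (deg b + u) (g b), ?_, ?_⟩
  · intro b
    simpa using isMultihomogeneous_component _ _ _
  · intro x
    refine LinearMap.congr_fun (f := d ∘ₗ _) (Finsupp.lhom_ext' fun b => LinearMap.ext_ring ?_) x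
    simp [hd.map_component, hg, (hφ b).component_eq]

theorem exists_lift_linear {d : (κ' →₀ 𝕊) →ₗ[𝕊] (κ →₀ 𝕊)} (φ : (ι →₀ 𝕊) →ₗ[𝕊] (κ →₀ 𝕊))
    (h : ∀ x, φ x ∈ LinearMap.range d) :
    ∃ ψ : (ι →₀ 𝕊) →ₗ[𝕊] (κ' →₀ 𝕊), ∀ x, d (ψ x) = φ x := by
  choose g hg using fun b => h (Finsupp.single b 1)
  refine ⟨Finsupp.linearCombination _ g, fun x => ?_⟩
  refine LinearMap.congr_fun (f := d ∘ₗ _) (Finsupp.lhom_ext' fun b => LinearMap.ext_ring ?_) x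
  simp [hg]

/-- A linear map whose values have all coordinates without constant term, that is, a map with image
in `(x_1, …, x_n) F`. -/
def IsMinimalMap (φ : (ι →₀ MvPolynomial (Fin n) k) →ₗ[MvPolynomial (Fin n) k]
    (κ →₀ MvPolynomial (Fin n) k)) : Prop :=
  ∀ x c, constantCoeff (φ x c) = 0

theorem isMinimalMap_of_single {φ : (ι →₀ 𝕊) →ₗ[𝕊] (κ →₀ 𝕊)}
    (h : ∀ b c, constantCoeff (φ (Finsupp.single b 1) c) = 0) : IsMinimalMap φ := by
  intro x c
  induction x using Finsupp.induction_linear with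
  | zero => simp
  | add f g hf hg => simp [hf, hg]
  | single b p =>
    rw [← mul_one p, ← smul_eq_mul, ← Finsupp.smul_single, map_smul]
    simp [h]

theorem constantCoeff_map_eq_zero (φ : (ι →₀ 𝕊) →ₗ[𝕊] (κ →₀ 𝕊)) {x : ι →₀ 𝕊}
    (h : ∀ b, constantCoeff (x b) = 0) (c : κ) : constantCoeff (φ x c) = 0 := by
  rw [← sum_smul_single x, map_sum, Finsupp.finsetSum_apply, map_sum]
  simp only [map_smul, Finsupp.smul_apply, smul_eq_mul, map_mul, h, zero_mul,
    Finset.sum_const_zero]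

theorem mem_idealOfVars_iff {p : 𝕊} : p ∈ idealOfVars (Fin n) k ↔ constantCoeff p = 0 := by
  rw [← pow_one (idealOfVars (Fin n) k), mem_pow_idealOfVars_iff']
  simp [Finsupp.degree_eq_zero_iff, constantCoeff_eq]

theorem range_le_idealOfVars_smul_top_iff {φ : (ι →₀ 𝕊) →ₗ[𝕊] (κ →₀ 𝕊)} :
    LinearMap.range φ ≤ (idealOfVars (Fin n) k • ⊤ : Submodule 𝕊 (κ →₀ 𝕊)) ↔ IsMinimalMap φ := by
  constructor
  · intro h x c
    have h1 := h ⟨x, rfl⟩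
    generalize φ x = y at h1
    induction h1 using Submodule.smul_induction_on' with
    | smul r hr m hm => simp [mem_idealOfVars_iff.1 hr]
    | add x hx y hy h1 h2 => simp [h1, h2]
  · rintro h _ ⟨x, rfl⟩
    rw [← Finsupp.sum_single (φ x)]
    refine Submodule.sum_mem _ fun c _ => ?_
    rw [← mul_one (φ x c), ← smul_eq_mul, ← Finsupp.smul_single]
    exact Submodule.smul_mem_smul (mem_idealOfVars_iff.2 (h x c)) trivial

/-! ### Minimal resolutions of cyclic modules -/

/-- A minimal multigraded free resolution `⋯ → F_1 → F_0 → S/I → 0` of the cyclic module `S/I`,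
where `F_0 = S` has the single basis vector `root` of multidegree `0`. The augmentation is
encoded by saying which multiples of `root` are boundaries. It is a minimal resolution of
`I`, shifted by one, together with the inclusion `I → S`; minimality is only required of the maps
between the terms of the resolution of `I`, so that `I = S` is allowed. -/
structure QuotientResolution (I : Ideal (MvPolynomial (Fin n) k)) where
  /-- the index set of the homogeneous basis of `F_i` -/
  ι : ℕ → Type
  finite : ∀ i, Finite (ι i)
  /-- the multidegrees of the basis elements of `F_i` -/
  deg : ∀ i, ι i → (Fin n →₀ ℕ)
  /-- the differentials `F_{i+1} → F_i` -/
  d : ∀ i, (ι (i + 1) →₀ MvPolynomial (Fin n) k) →ₗ[MvPolynomial (Fin n) k]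
    (ι i →₀ MvPolynomial (Fin n) k)
  graded : ∀ i, IsGradedMap (deg (i + 1)) (deg i) 0 (d i)
  exact : ∀ i, Function.Exact (d (i + 1)) (d i)
  /-- the basis vector of `F_0` -/
  root : ι 0
  eq_root : ∀ b, b = root
  deg_root : deg 0 root = 0
  mem_range : ∀ f, Finsupp.single root f ∈ LinearMap.range (d 0) ↔ f ∈ I
  minimal : ∀ i, IsMinimalMap (d (i + 1))

namespace QuotientResolution

variable {I J : Ideal (MvPolynomial (Fin n) k)}

theorem single_apply_root (F : QuotientResolution I) (x : F.ι 0 →₀ 𝕊) :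
    Finsupp.single F.root (x F.root) = x := by
  ext1 b
  rw [F.eq_root b, Finsupp.single_eq_same]

theorem d_d (F : QuotientResolution I) (i : ℕ) (x) : F.d i (F.d (i + 1) x) = 0 :=
  (F.exact i).apply_apply_eq_zero x

/-- Multiplication by `x^u`, if it maps `J` into `I`, lifts to a map of resolutions. -/
theorem exists_comparison (F : QuotientResolution I) (G : QuotientResolution J) (u : Fin n →₀ ℕ)
    (h : ∀ f ∈ J, monomial u 1 * f ∈ I) :
    ∃ φ : ∀ i, (G.ι i →₀ 𝕊) →ₗ[𝕊] (F.ι i →₀ 𝕊),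
      (∀ x, φ 0 (Finsupp.single G.root x) = Finsupp.single F.root (monomial u 1 * x)) ∧
      (∀ i, IsGradedMap (G.deg i) (F.deg i) u (φ i)) ∧
      ∀ i x, F.d i (φ (i + 1) x) = φ i (G.d i x) := by
  let T : ℕ → Type _ := fun i => {φ : (G.ι i →₀ 𝕊) →ₗ[𝕊] (F.ι i →₀ 𝕊) //
    IsGradedMap (G.deg i) (F.deg i) u φ ∧ ∀ x, φ (G.d i x) ∈ LinearMap.range (F.d i)}
  have step : ∀ i (φ : T i), ∃ ψ : T (i + 1), ∀ x, F.d i (ψ.1 x) = φ.1 (G.d i x) := by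
    rintro i ⟨φ, hφ, hr⟩
    have hg : IsGradedMap (G.deg (i + 1)) (F.deg i) u (φ ∘ₗ G.d i) := by
      simpa using hφ.comp (G.graded i)
    obtain ⟨ψ, hψ, hd⟩ := hg.exists_lift (F.graded i) (fun x => hr x)
    refine ⟨⟨ψ, hψ, fun x => ?_⟩, hd⟩
    refine (F.exact i _).1 ?_
    rw [hd, LinearMap.comp_apply, G.d_d, map_zero]
  let φ0 : (G.ι 0 →₀ 𝕊) →ₗ[𝕊] (F.ι 0 →₀ 𝕊) :=
    Finsupp.linearCombination _ fun _ => Finsupp.single F.root (monomial u 1)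
  have hφ0 : ∀ x, φ0 (Finsupp.single G.root x) = Finsupp.single F.root (monomial u 1 * x) := by
    intro x
    simp [φ0, mul_comm]
  let t0 : T 0 := ⟨φ0, fun b => by
      rw [G.eq_root b, hφ0, mul_one, G.deg_root, zero_add]
      simpa [F.deg_root] using isMultihomogeneous_single (k := k) (F.deg 0) F.root u 1, fun x => by
      rw [← G.single_apply_root (G.d 0 x), hφ0, F.mem_range]
      refine h _ ((G.mem_range _).1 ?_)
      rw [G.single_apply_root]
      exact ⟨x, rfl⟩⟩
  choose next hnext using step
  let t : ∀ i, T i := fun i => Nat.rec t0 next i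
  exact ⟨fun i => (t i).1, hφ0, fun i => (t i).2.1, fun i => hnext i (t i)⟩

/-- A chain endomorphism of a minimal resolution that vanishes on `F_0` is null-homotopic, hence
zero modulo the variables. -/
theorem isMinimalMap_of_chain (F : QuotientResolution I)
    (θ : ∀ i, (F.ι i →₀ 𝕊) →ₗ[𝕊] (F.ι i →₀ 𝕊)) (h0 : θ 0 = 0)
    (hθ : ∀ i x, F.d i (θ (i + 1) x) = θ i (F.d i x)) (i : ℕ) : IsMinimalMap (θ i) := by
  have key : ∀ i, ∃ h : (F.ι i →₀ 𝕊) →ₗ[𝕊] (F.ι (i + 1) →₀ 𝕊),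
      (∀ x, θ i (F.d i x) = F.d i (h (F.d i x))) ∧ IsMinimalMap (h ∘ₗ F.d i) ∧
        IsMinimalMap (θ i) := by
    intro i
    induction i with
    | zero => exact ⟨0, by simp [h0], by simp [IsMinimalMap], by simp [IsMinimalMap, h0]⟩
    | succ i ih =>
      obtain ⟨h, h1, h2, -⟩ := ih
      obtain ⟨h', hh'⟩ := exists_lift_linear (d := F.d (i + 1)) (θ (i + 1) - h ∘ₗ F.d i)
        fun x => (F.exact i _).1 (by simp [hθ, h1])
      simp only [LinearMap.sub_apply, LinearMap.comp_apply] at hh'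
      refine ⟨h', fun x => by simp [hh', F.d_d], fun x c => ?_, fun x c => ?_⟩
      · exact constantCoeff_map_eq_zero h' (F.minimal i x) c
      · have h3 := F.minimal i (h' x) c
        have h4 := h2 x c
        rw [hh'] at h3
        rw [LinearMap.comp_apply] at h4
        simpa [h4] using h3
  obtain ⟨-, -, -, h⟩ := key i
  exact h

/-- The multidegrees occurring in a minimal resolution depend on the ideal only: two comparison maps
compose to the identity modulo the variables, so they match up basis vectors of equal multidegree.
-/
theorem range_deg_subset (F G : QuotientResolution I) (i : ℕ) :
    Set.range (F.deg i) ⊆ Set.range (G.deg i) := by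
  rintro _ ⟨b, rfl⟩
  obtain ⟨φ, hφ0, hφ, hφd⟩ := G.exists_comparison F 0 (by simp)
  obtain ⟨ψ, hψ0, -, hψd⟩ := F.exists_comparison G 0 (by simp)
  have h := F.isMinimalMap_of_chain (fun i => ψ i ∘ₗ φ i - LinearMap.id) (by
      ext1 c
      refine LinearMap.ext_ring ?_
      have h1 : (monomial 0 1 : 𝕊) = 1 := rfl
      simp [F.eq_root c, hφ0, hψ0, h1]) (by simp [hφd, hψd]) i (Finsupp.single b 1) b
  by_contra hb
  -- A constant term in a coordinate of `φ e_b` would give a basis vector of the same multidegree.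
  have hc : ∀ c, constantCoeff (φ i (Finsupp.single b 1) c) = 0 := by
    intro c
    by_contra hne
    have h2 := isMultihomogeneous_iff_coeff.1 (hφ i b) c 0 (by simpa [constantCoeff_eq] using hne)
    exact hb ⟨c, by simpa using h2⟩
  simp [constantCoeff_map_eq_zero (ψ i) hc b] at h

/-- Dropping `F_0 = S` from a resolution of `S/I` leaves a resolution of `I`. -/
noncomputable def toMinimalResolution (F : QuotientResolution I) : MinimalResolution I where
  ι i := F.ι (i + 1)
  finite i := F.finite (i + 1)
  deg i := F.deg (i + 1)
  aug := Finsupp.lapply F.root ∘ₗ F.d 0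
  d i := F.d (i + 1)
  aug_homogeneous b m hm := by
    simpa [F.deg_root] using F.graded 0 b F.root m hm
  d_homogeneous i b := by simpa using F.graded (i + 1) b
  range_aug := by
    ext f
    rw [← F.mem_range]
    constructor
    · rintro ⟨x, rfl⟩
      exact ⟨x, (F.single_apply_root _).symm⟩
    · rintro ⟨x, hx⟩
      exact ⟨x, by simp [hx]⟩
  exact_zero x := by
    rw [← F.exact 0 x, ← F.single_apply_root (F.d 0 x)]
    simp
  exact_succ i := F.exact (i + 1)
  minimal i := range_le_idealOfVars_smul_top_iff.2 (F.minimal i)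

end QuotientResolution

namespace MinimalResolution

variable {I : Ideal (MvPolynomial (Fin n) k)}

/-- The augmentation, viewed as a map to the free module of rank one. -/
noncomputable def augUnit (F : MinimalResolution I) : (F.ι 0 →₀ 𝕊) →ₗ[𝕊] (Unit →₀ 𝕊) :=
  Finsupp.lsingle () ∘ₗ F.aug

theorem isGradedMap_augUnit (F : MinimalResolution I) :
    IsGradedMap (F.deg 0) (fun _ => 0) 0 F.augUnit := fun b _ m hm => by
  simpa using F.aug_homogeneous b m (by simpa [augUnit] using hm)

theorem exact_augUnit (F : MinimalResolution I) : Function.Exact (F.d 0) F.augUnit := fun x => by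
  rw [← F.exact_zero x]
  simp [augUnit]

theorem mem_range_augUnit (F : MinimalResolution I) (f : 𝕊) :
    Finsupp.single () f ∈ LinearMap.range F.augUnit ↔ f ∈ I := by
  conv_rhs => rw [← F.range_aug]
  constructor
  · rintro ⟨x, hx⟩
    exact ⟨x, by simpa [augUnit] using DFunLike.congr_fun hx ()⟩
  · rintro ⟨x, rfl⟩
    exact ⟨x, rfl⟩

/-- The index sets of the resolution of `S/I` obtained from a resolution of `I`. -/
abbrev quotientι (F : MinimalResolution I) : ℕ → Type
  | 0 => Unit
  | i + 1 => F.ι i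

/-- The resolution of `S/I` obtained from a resolution of `I` by composing the augmentation with
the inclusion `I → S`. -/
noncomputable def toQuotientResolution (F : MinimalResolution I) : QuotientResolution I where
  ι := F.quotientι
  finite
    | 0 => inferInstanceAs (Finite Unit)
    | i + 1 => F.finite i
  deg
    | 0 => fun _ => 0
    | i + 1 => F.deg i
  d
    | 0 => F.augUnit
    | i + 1 => F.d i
  graded
    | 0 => F.isGradedMap_augUnit
    | i + 1 => fun b => (add_zero (F.deg (i + 1) b)).symm ▸ F.d_homogeneous i b
  exact
    | 0 => F.exact_augUnit
    | i + 1 => F.exact_succ i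
  root := ()
  eq_root _ := rfl
  deg_root := rfl
  mem_range := F.mem_range_augUnit
  minimal i := range_le_idealOfVars_smul_top_iff.1 (F.minimal i)

theorem betti_ne_zero_iff (F : MinimalResolution I) (i : ℕ) (a : Fin n →₀ ℕ) :
    F.betti i a ≠ 0 ↔ a ∈ Set.range (F.deg i) := by
  have := F.finite i
  rw [betti, Nat.card_ne_zero]
  constructor
  · rintro ⟨⟨b, hb⟩, -⟩
    exact ⟨b, hb⟩
  · rintro ⟨b, hb⟩
    exact ⟨⟨b, hb⟩, inferInstance⟩

end MinimalResolution

/-- Any one minimal resolution computes the homological shift ideals. -/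
theorem HS_eq_span (i : ℕ) {I : Ideal 𝕊} (F : QuotientResolution I) :
    HS i I = Ideal.span ((fun a => monomial a (1 : k)) '' Set.range (F.deg (i + 1))) := by
  rw [HS]
  congr 1
  ext f
  constructor
  · rintro ⟨G, a, ha, rfl⟩
    rw [G.betti_ne_zero_iff] at ha
    exact ⟨a, G.toQuotientResolution.range_deg_subset F (i + 1) ha, rfl⟩
  · rintro ⟨a, ha, rfl⟩
    exact ⟨F.toMinimalResolution, a, (F.toMinimalResolution.betti_ne_zero_iff i a).2 ha, rfl⟩

/-! ### Mapping cones -/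

section Cone

variable {α α' α'' β β' β'' : Type*}

/-- The differential `(x, y) ↦ (d x + φ y, -e y)` of the mapping cone of `φ`. -/
noncomputable def coneD (d : (α' →₀ MvPolynomial (Fin n) k) →ₗ[MvPolynomial (Fin n) k]
      (α →₀ MvPolynomial (Fin n) k))
    (e : (β' →₀ MvPolynomial (Fin n) k) →ₗ[MvPolynomial (Fin n) k]
      (β →₀ MvPolynomial (Fin n) k))
    (φ : (β' →₀ MvPolynomial (Fin n) k) →ₗ[MvPolynomial (Fin n) k]
      (α →₀ MvPolynomial (Fin n) k)) :
    (α' ⊕ β' →₀ MvPolynomial (Fin n) k) →ₗ[MvPolynomial (Fin n) k]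
      (α ⊕ β →₀ MvPolynomial (Fin n) k) :=
  (Finsupp.sumFinsuppLEquivProdFinsupp _).symm.toLinearMap ∘ₗ
    LinearMap.prod (d ∘ₗ LinearMap.fst _ _ _ + φ ∘ₗ LinearMap.snd _ _ _)
      (-(e ∘ₗ LinearMap.snd _ _ _)) ∘ₗ (Finsupp.sumFinsuppLEquivProdFinsupp _).toLinearMap

variable {d : (α' →₀ MvPolynomial (Fin n) k) →ₗ[MvPolynomial (Fin n) k]
    (α →₀ MvPolynomial (Fin n) k)}
  {e : (β' →₀ MvPolynomial (Fin n) k) →ₗ[MvPolynomial (Fin n) k] (β →₀ MvPolynomial (Fin n) k)}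
  {φ : (β' →₀ MvPolynomial (Fin n) k) →ₗ[MvPolynomial (Fin n) k] (α →₀ MvPolynomial (Fin n) k)}
  {d' : (α'' →₀ MvPolynomial (Fin n) k) →ₗ[MvPolynomial (Fin n) k]
    (α' →₀ MvPolynomial (Fin n) k)}
  {e' : (β'' →₀ MvPolynomial (Fin n) k) →ₗ[MvPolynomial (Fin n) k]
    (β' →₀ MvPolynomial (Fin n) k)}
  {φ' : (β'' →₀ MvPolynomial (Fin n) k) →ₗ[MvPolynomial (Fin n) k]
    (α' →₀ MvPolynomial (Fin n) k)}

theorem coneD_symm (x : (α' →₀ 𝕊) × (β' →₀ 𝕊)) :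
    coneD d e φ ((Finsupp.sumFinsuppLEquivProdFinsupp 𝕊).symm x) =
      (Finsupp.sumFinsuppLEquivProdFinsupp 𝕊).symm (d x.1 + φ x.2, -e x.2) := by
  simp [coneD]

theorem single_inl (a : α) (f : 𝕊) : (Finsupp.single (Sum.inl a) f : α ⊕ β →₀ 𝕊) =
    (Finsupp.sumFinsuppLEquivProdFinsupp 𝕊).symm (Finsupp.single a f, 0) := by
  classical
  ext1 (c | c) <;> simp [Finsupp.single_apply]

theorem single_inr (b : β) (f : 𝕊) : (Finsupp.single (Sum.inr b) f : α ⊕ β →₀ 𝕊) =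
    (Finsupp.sumFinsuppLEquivProdFinsupp 𝕊).symm (0, Finsupp.single b f) := by
  classical
  ext1 (c | c) <;> simp [Finsupp.single_apply]

theorem exact_coneD (hd : Function.Exact d' d) (he : ∀ z, e (e' z) = 0)
    (hφ : ∀ z, d (φ' z) = φ (e' z))
    (hr : ∀ y, e y = 0 → φ y ∈ LinearMap.range d → y ∈ LinearMap.range e') :
    Function.Exact (coneD d' e' φ') (coneD d e φ) := by
  intro x
  obtain ⟨⟨x, y⟩, rfl⟩ := (Finsupp.sumFinsuppLEquivProdFinsupp 𝕊).symm.surjective x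
  rw [coneD_symm, LinearEquiv.map_eq_zero_iff, Prod.mk_eq_zero, neg_eq_zero]
  constructor
  · rintro ⟨h1, h2⟩
    obtain ⟨z, rfl⟩ := hr y h2 ⟨-x, by rw [map_neg]; exact neg_eq_of_add_eq_zero_right h1⟩
    dsimp only at h1
    obtain ⟨w, hw⟩ := (hd (x + φ' z)).1 (by rw [map_add, hφ, h1])
    exact ⟨(Finsupp.sumFinsuppLEquivProdFinsupp 𝕊).symm (w, -z), by rw [coneD_symm]; simp [hw]⟩
  · rintro ⟨w, hw⟩
    obtain ⟨⟨w, z⟩, rfl⟩ := (Finsupp.sumFinsuppLEquivProdFinsupp 𝕊).symm.surjective w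
    rw [coneD_symm, EmbeddingLike.apply_eq_iff_eq, Prod.mk.injEq] at hw
    obtain ⟨rfl, rfl⟩ := hw
    simp [hd.apply_apply_eq_zero, hφ, he]

theorem isGradedMap_coneD {dα : α → (Fin n →₀ ℕ)} {dα' : α' → (Fin n →₀ ℕ)}
    {dβ : β → (Fin n →₀ ℕ)} {dβ' : β' → (Fin n →₀ ℕ)} (hd : IsGradedMap dα' dα 0 d)
    (he : IsGradedMap dβ' dβ 0 e) (hφ : IsGradedMap dβ' dα 0 φ) :
    IsGradedMap (Sum.elim dα' dβ') (Sum.elim dα dβ) 0 (coneD d e φ) := by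
  rintro (a | b) (c | c) m hm
  · rw [single_inl, coneD_symm] at hm
    exact hd a c m (by simpa using hm)
  · rw [single_inl, coneD_symm] at hm
    simp at hm
  · rw [single_inr, coneD_symm] at hm
    exact hφ b c m (by simpa using hm)
  · rw [single_inr, coneD_symm] at hm
    exact he b c m (by simpa using hm)

theorem isMinimalMap_coneD (hd : IsMinimalMap d) (he : IsMinimalMap e) (hφ : IsMinimalMap φ) :
    IsMinimalMap (coneD d e φ) := by
  intro x c
  obtain ⟨⟨x, y⟩, rfl⟩ := (Finsupp.sumFinsuppLEquivProdFinsupp 𝕊).symm.surjective x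
  rw [coneD_symm]
  rcases c with c | c
  · simpa using by rw [hd x c, hφ y c, add_zero]
  · simpa using he y c

end Cone

/-- A graded map is minimal when no basis vectors of source and target have matching
multidegrees. -/
theorem IsGradedMap.isMinimalMap {ι κ : Type*} {deg : ι → (Fin n →₀ ℕ)} {deg' : κ → (Fin n →₀ ℕ)}
    {u : Fin n →₀ ℕ} {φ : (ι →₀ 𝕊) →ₗ[𝕊] (κ →₀ 𝕊)} (hφ : IsGradedMap deg deg' u φ)
    (h : ∀ b c, deg' c ≠ deg b + u) : IsMinimalMap φ := by
  refine isMinimalMap_of_single fun b c => ?_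
  by_contra hne
  exact h b c (by
    simpa using isMultihomogeneous_iff_coeff.1 (hφ b) c 0 (by simpa [constantCoeff_eq] using hne))

namespace QuotientResolution

variable {I J I' : Ideal (MvPolynomial (Fin n) k)}

/-- The index sets of `G[-1]`. -/
abbrev shiftι (G : QuotientResolution J) : ℕ → Type
  | 0 => Empty
  | i + 1 => G.ι i

/-- The multidegrees of `G[-1] ⊗ S(x^u)`. -/
noncomputable def shiftDeg (G : QuotientResolution J) (u : Fin n →₀ ℕ) :
    ∀ i, G.shiftι i → (Fin n →₀ ℕ)
  | 0 => fun _ => 0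
  | i + 1 => fun b => G.deg i b + u

/-- The differentials of `G[-1]`, without the sign. -/
noncomputable def shiftD (G : QuotientResolution J) :
    ∀ i, (G.shiftι (i + 1) →₀ 𝕊) →ₗ[𝕊] (G.shiftι i →₀ 𝕊)
  | 0 => 0
  | i + 1 => G.d i

theorem isGradedMap_shiftD (G : QuotientResolution J) (u : Fin n →₀ ℕ) :
    ∀ i, IsGradedMap (G.shiftDeg u (i + 1)) (G.shiftDeg u i) 0 (G.shiftD i)
  | 0 => fun b c => c.elim
  | i + 1 => fun b c m hm => by
    have := G.graded i b c m hm
    simp only [shiftDeg]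
    rw [← add_assoc, this, add_zero, add_zero]

theorem shiftD_shiftD (G : QuotientResolution J) :
    ∀ i x, G.shiftD i (G.shiftD (i + 1) x) = 0
  | 0 => fun _ => rfl
  | i + 1 => G.d_d i

theorem minimal_d_zero (G : QuotientResolution J) (hJ : J ≠ ⊤) : IsMinimalMap (G.d 0) := by
  refine isMinimalMap_of_single fun b c => ?_
  by_contra hne
  refine hJ ((Ideal.eq_top_iff_one J).2 ?_)
  rw [G.eq_root c] at hne
  have h := isMultihomogeneous_iff_coeff.1 (G.graded 0 b) G.root
  set p := G.d 0 (Finsupp.single b 1) G.root with hp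
  have hb := h 0 (by simpa [constantCoeff_eq] using hne)
  -- `p` is multihomogeneous with a constant term, hence a nonzero constant.
  have hpC : p = C (constantCoeff p) := by
    ext m
    rw [coeff_C]
    split_ifs with hm
    · rw [← hm, constantCoeff_eq]
    · by_contra hm'
      exact hm (add_right_cancel ((h m hm').trans hb.symm)).symm
  have hpJ : p ∈ J := by
    rw [← G.mem_range, hp, G.single_apply_root]
    exact ⟨_, rfl⟩
  have h1 := J.mul_mem_left (C (constantCoeff p)⁻¹) hpJ
  rwa [hpC, ← C_mul, constantCoeff_C, inv_mul_cancel₀ hne, C_1] at h1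

/-- If `J = I : x^u`, the mapping cone of a lift of `x^u : S/J → S/I` to minimal resolutions
resolves `S/(I + (x^u))`. It is minimal when no two basis vectors of the same homological degree
`i ≥ 1` have the same multidegree. -/
theorem exists_cone (F : QuotientResolution I) (G : QuotientResolution J) (u : Fin n →₀ ℕ)
    (hJ : ∀ f, f ∈ J ↔ monomial u 1 * f ∈ I) (hJ' : J ≠ ⊤)
    (hI' : I' = I ⊔ Ideal.span {monomial u 1})
    (hdeg : ∀ i b c, F.deg (i + 1) b ≠ G.deg (i + 1) c + u) :
    ∃ F' : QuotientResolution I', ∀ i, Set.range (F'.deg (i + 1)) =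
      Set.range (F.deg (i + 1)) ∪ Set.range fun c => G.deg i c + u := by
  obtain ⟨φ, hφ0, hφ, hφd⟩ := F.exists_comparison G u fun f hf => (hJ f).1 hf
  have hφ' : ∀ i, IsGradedMap (G.shiftDeg u (i + 1)) (F.deg i) 0 (φ i) :=
    fun i b => by simpa [shiftDeg] using hφ i b
  have key : ∀ i y, G.shiftD i y = 0 → φ i y ∈ LinearMap.range (F.d i) →
      y ∈ LinearMap.range (G.shiftD (i + 1)) := by
    rintro (_ | i) y h1 h2
    · rw [← G.single_apply_root y] at h2 ⊢
      rw [hφ0, F.mem_range, ← hJ, ← G.mem_range] at h2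
      exact h2
    · exact (G.exact i y).1 h1
  refine ⟨{
    ι := fun i => F.ι i ⊕ G.shiftι i
    finite := ?_
    deg := fun i => Sum.elim (F.deg i) (G.shiftDeg u i)
    d := fun i => coneD (F.d i) (G.shiftD i) (φ i)
    graded := fun i => isGradedMap_coneD (F.graded i) (G.isGradedMap_shiftD u i) (hφ' i)
    exact := fun i => exact_coneD (F.exact i) (G.shiftD_shiftD i) (hφd i) (key i)
    root := Sum.inl F.root
    eq_root := ?_
    deg_root := F.deg_root
    mem_range := ?_
    minimal := ?_ }, fun i => by simp [shiftDeg, Set.Sum.elim_range]⟩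
  · rintro (_ | i)
    · have := F.finite 0
      exact inferInstanceAs (Finite (F.ι 0 ⊕ Empty))
    · have := F.finite (i + 1)
      have := G.finite i
      exact inferInstanceAs (Finite (F.ι (i + 1) ⊕ G.ι i))
  · rintro (b | b)
    · rw [F.eq_root b]
    · exact b.elim
  · intro f
    rw [hI', Submodule.mem_sup, single_inl]
    constructor
    · rintro ⟨x, hx⟩
      obtain ⟨⟨x, y⟩, rfl⟩ := (Finsupp.sumFinsuppLEquivProdFinsupp 𝕊).symm.surjective x
      rw [coneD_symm, EmbeddingLike.apply_eq_iff_eq, Prod.mk.injEq] at hx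
      have h1 := DFunLike.congr_fun hx.1 F.root
      dsimp only at h1
      rw [← G.single_apply_root y, hφ0] at h1
      refine ⟨F.d 0 x F.root, (F.mem_range _).1 ?_, _,
        Ideal.mul_mem_right (y G.root) _ (Ideal.mem_span_singleton_self (monomial u 1)), ?_⟩
      · rw [F.single_apply_root]; exact ⟨x, rfl⟩
      · simpa using h1
    · rintro ⟨g, hg, h, hh, rfl⟩
      obtain ⟨h, rfl⟩ := Ideal.mem_span_singleton'.1 hh
      obtain ⟨x, hx⟩ := (F.mem_range g).2 hg
      refine ⟨(Finsupp.sumFinsuppLEquivProdFinsupp 𝕊).symm (x, Finsupp.single G.root h), ?_⟩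
      rw [coneD_symm]
      congr 2
      · dsimp only
        rw [hx, hφ0, ← Finsupp.single_add, mul_comm]
      · ext b; exact b.elim
  · intro i
    refine isMinimalMap_coneD (F.minimal i) ?_ ((hφ (i + 1)).isMinimalMap fun b c => hdeg i c b)
    cases i with
    | zero => exact G.minimal_d_zero hJ'
    | succ i => exact G.minimal i

end QuotientResolution

/-! ### Squarefree stable families -/

section Stable

/-- A family of subsets of `{1, …, n}` is squarefree stable if it is closed under replacing the
largest element of a member by a smaller one. Identifying squarefree monomials with
their supports, these are the squarefree monomials of a squarefree stable ideal. -/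
def IsStable (𝒜 : Set (Finset (Fin n))) : Prop :=
  ∀ A ∈ 𝒜, ∀ m ∈ A, (∀ x ∈ A, x ≤ m) → ∀ s < m, s ∉ A → insert s (A.erase m) ∈ 𝒜

/-- The elements outside `u` that are smaller than the largest element of `u`. -/
def gaps (u : Finset (Fin n)) : Finset (Fin n) :=
  Finset.univ.filter fun s => s ∉ u ∧ ∃ w ∈ u, s < w

theorem mem_gaps {u : Finset (Fin n)} {s : Fin n} : s ∈ gaps u ↔ s ∉ u ∧ ∃ w ∈ u, s < w := by
  simp [gaps]

/-- The sets `u ∪ σ` with `u` a minimal member of `𝒜` and `σ` a set of `j` gaps of `u`; these turn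
out to be the multidegrees of the `j`th step of the minimal resolution. -/
def shiftGens (𝒜 : Set (Finset (Fin n))) (j : ℕ) : Set (Finset (Fin n)) :=
  {D | ∃ u σ, Minimal (· ∈ 𝒜) u ∧ σ ⊆ gaps u ∧ σ.card = j ∧ u ∪ σ = D}

/-- The sets containing a member of `shiftGens 𝒜 j`. -/
def shiftUp (𝒜 : Set (Finset (Fin n))) (j : ℕ) : Set (Finset (Fin n)) :=
  {B | ∃ D ∈ shiftGens 𝒜 j, D ⊆ B}

variable {𝒜 : Set (Finset (Fin n))}

theorem exists_minimal_subset {B : Finset (Fin n)} (hB : B ∈ 𝒜) :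
    ∃ u ⊆ B, Minimal (· ∈ 𝒜) u := by
  obtain ⟨u, hu, hmin⟩ := (Set.toFinite 𝒜).exists_le_minimal hB
  exact ⟨u, hu, hmin⟩

theorem shiftUp_of_minimal {B : Finset (Fin n)} {j : ℕ} (hB : Minimal (· ∈ shiftUp 𝒜 j) B) :
    B ∈ shiftGens 𝒜 j := by
  obtain ⟨D, hD, hDB⟩ := hB.prop
  rwa [← hB.eq_of_le ⟨D, hD, subset_rfl⟩ hDB]

/-- The homological shifts of a squarefree Borel family need not be Borel, but shifts of a stable
family are stable. -/
theorem IsStable.shift (h : IsStable 𝒜) (j : ℕ) :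
    IsStable (shiftUp 𝒜 j) := by
  rintro A ⟨D, ⟨u, σ, hu, hσ, hj, rfl⟩, hDA⟩ m hm hmax s hs hsA
  by_cases hmD : m ∈ u ∪ σ
  swap
  · exact ⟨u ∪ σ, ⟨u, σ, hu, hσ, hj, rfl⟩, fun x hx => Finset.mem_insert_of_mem
      (Finset.mem_erase.2 ⟨fun hxm => hmD (hxm ▸ hx), hDA hx⟩)⟩
  have hmaxu : ∀ x ∈ u, x ≤ m := fun x hx => hmax x (hDA (Finset.mem_union_left _ hx))
  have hσm : ∀ x ∈ σ, x < m := fun x hx => by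
    obtain ⟨-, w, hw, hxw⟩ := mem_gaps.1 (hσ hx)
    exact hxw.trans_le (hmaxu w hw)
  have hmu : m ∈ u := by
    rcases Finset.mem_union.1 hmD with h | h
    · exact h
    · exact absurd (hσm m h) (lt_irrefl m)
  have hsu : s ∉ u := fun h => hsA (hDA (Finset.mem_union_left _ h))
  have hsσ : s ∉ σ := fun h => hsA (hDA (Finset.mem_union_right _ h))
  -- Among `u - m + c` with `c ∈ σ ∪ {s}` take the one with the largest `c`.
  obtain ⟨c, hc, hcmax⟩ := (insert s σ).exists_max_image id ⟨s, Finset.mem_insert_self _ _⟩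
  have hcm : c < m := by
    rcases Finset.mem_insert.1 hc with rfl | h
    · exact hs
    · exact hσm c h
  have hnot : ∀ x ∈ insert s σ, x ∉ u := by
    intro x hx
    rcases Finset.mem_insert.1 hx with rfl | h
    · exact hsu
    · exact (mem_gaps.1 (hσ h)).1
  have hmem := h u hu.prop m hmu hmaxu c hcm (hnot c hc)
  obtain ⟨y, hy, hymin⟩ := exists_minimal_subset hmem
  have hcy : c ∈ y := by
    by_contra hcy
    have hyu : y ⊆ u.erase m := fun x hx =>
      (Finset.mem_insert.1 (hy hx)).resolve_left fun e => hcy (e ▸ hx)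
    have := hu.eq_of_le hymin.prop (hyu.trans (Finset.erase_subset _ _))
    exact Finset.notMem_erase m u (hyu (this ▸ hmu))
  refine ⟨y ∪ (insert s σ).erase c, ⟨y, _, hymin, ?_, ?_, rfl⟩, ?_⟩
  · intro x hx
    obtain ⟨hxc, hx⟩ := Finset.mem_erase.1 hx
    refine mem_gaps.2 ⟨fun hxy => ?_, c, hcy, lt_of_le_of_ne (hcmax x hx) hxc⟩
    exact hnot x hx (Finset.mem_of_mem_erase ((Finset.mem_insert.1 (hy hxy)).resolve_left hxc))
  · rw [Finset.card_erase_of_mem hc, Finset.card_insert_of_notMem hsσ, hj, Nat.add_sub_cancel]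
  · have h1 : insert s σ ⊆ insert s (A.erase m) := by
      refine Finset.insert_subset_insert s fun x hx => ?_
      exact Finset.mem_erase.2 ⟨(hσm x hx).ne, hDA (Finset.mem_union_right _ hx)⟩
    refine Finset.union_subset (fun x hx => ?_) ((Finset.erase_subset _ _).trans h1)
    rcases Finset.mem_insert.1 (hy hx) with rfl | hx
    · exact h1 hc
    · obtain ⟨hxm, hxu⟩ := Finset.mem_erase.1 hx
      exact Finset.mem_insert_of_mem
        (Finset.mem_erase.2 ⟨hxm, hDA (Finset.mem_union_left _ hxu)⟩)

theorem exists_subset_card_of_largest {α : Type*} [LinearOrder α] (ρ : Finset α) {j : ℕ}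
    (hj : j ≤ ρ.card) : ∃ σ ⊆ ρ, σ.card = j ∧ ∀ s ∈ σ, ∀ t ∈ ρ \ σ, t < s := by
  induction j with
  | zero => exact ⟨∅, by simp⟩
  | succ j ih =>
    obtain ⟨σ, hσ, hcard, hlt⟩ := ih (by omega)
    have hne : (ρ \ σ).Nonempty := by
      rw [← Finset.card_pos, Finset.card_sdiff_of_subset hσ]; omega
    have hm := (ρ \ σ).max'_mem hne
    refine ⟨insert ((ρ \ σ).max' hne) σ, ?_, ?_, ?_⟩
    · exact Finset.insert_subset (Finset.sdiff_subset hm) hσ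
    · rw [Finset.card_insert_of_notMem (Finset.mem_sdiff.1 hm).2, hcard]
    · intro s hs t ht
      have ht' : t ∈ ρ \ σ ∧ t ≠ (ρ \ σ).max' hne := by
        simp only [Finset.mem_sdiff, Finset.mem_insert, not_or] at ht ⊢
        tauto
      rcases Finset.mem_insert.1 hs with rfl | hs
      · exact lt_of_le_of_ne (Finset.le_max' _ _ ht'.1) ht'.2
      · exact hlt s hs t ht'.1

/-- Shifting twice is shifting once. -/
theorem shiftUp_shiftUp (𝒜 : Set (Finset (Fin n))) (i j : ℕ) :
    shiftUp (shiftUp 𝒜 j) i = shiftUp 𝒜 (i + j) := by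
  ext B
  constructor
  · rintro ⟨D, ⟨v, τ, hv, hτ, hi, rfl⟩, hDB⟩
    obtain ⟨u, σ, hu, hσ, hj, rfl⟩ := shiftUp_of_minimal hv
    refine ⟨_, ⟨u, τ ∪ σ, hu, fun t ht => ?_, ?_, ?_⟩, hDB⟩
    · rcases Finset.mem_union.1 ht with ht | ht
      · obtain ⟨htu, w, hw, htw⟩ := mem_gaps.1 (hτ ht)
        refine mem_gaps.2 ⟨fun h => htu (Finset.mem_union_left _ h), ?_⟩
        rcases Finset.mem_union.1 hw with hw | hw
        · exact ⟨w, hw, htw⟩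
        · obtain ⟨-, w', hw', h⟩ := mem_gaps.1 (hσ hw)
          exact ⟨w', hw', htw.trans h⟩
      · exact hσ ht
    · rw [Finset.card_union_of_disjoint, hi, hj]
      rw [Finset.disjoint_left]
      exact fun t ht h => (mem_gaps.1 (hτ ht)).1 (Finset.mem_union_right _ h)
    · rw [Finset.union_assoc, Finset.union_comm σ]
  · rintro ⟨D, ⟨u, ρ, hu, hρ, hij, rfl⟩, hDB⟩
    -- Use the largest `j` gaps of `ρ` for the first shift and the others for the second.
    obtain ⟨σ, hσρ, hj, hlt⟩ := exists_subset_card_of_largest ρ (j := j) (by omega)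
    have hC : u ∪ σ ∈ shiftUp 𝒜 j := ⟨_, ⟨u, σ, hu, hσρ.trans hρ, hj, rfl⟩, subset_rfl⟩
    obtain ⟨v, hvC, hv⟩ := exists_minimal_subset hC
    refine ⟨_, ⟨v, ρ \ σ, hv, fun t ht => ?_, ?_, rfl⟩, ?_⟩
    · obtain ⟨htρ, htσ⟩ := Finset.mem_sdiff.1 ht
      obtain ⟨htu, w, hw, htw⟩ := mem_gaps.1 (hρ htρ)
      refine mem_gaps.2 ⟨fun htv => (Finset.mem_union.1 (hvC htv)).elim htu htσ, ?_⟩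
      by_contra! hcon
      -- If `t` exceeds all of `v`, then so does `σ`, hence `v ⊆ u`, which forces `u ⊆ v`.
      have hvu : v ⊆ u := fun x hx => (Finset.mem_union.1 (hvC hx)).resolve_right
        fun hxσ => absurd (hlt x hxσ t ht) (not_lt.2 (hcon x hx))
      obtain ⟨u', σ', hu', -, -, rfl⟩ := shiftUp_of_minimal hv
      have := hu.eq_of_le hu'.prop (Finset.subset_union_left.trans hvu)
      subst this
      exact absurd htw (not_lt.2 (hcon w (Finset.mem_union_left _ hw)))
    · rw [Finset.card_sdiff_of_subset hσρ]; omega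
    · refine (Finset.union_subset (hvC.trans ?_) ?_).trans hDB
      · exact Finset.union_subset_union_right hσρ
      · exact Finset.sdiff_subset.trans Finset.subset_union_right

/-- Replacing the largest elements of `A`, which lie outside `u`, by elements of `u`. -/
theorem IsStable.exists_subset (h : IsStable 𝒜) {u : Finset (Fin n)} (A : Finset (Fin n))
    (hA : A ∈ 𝒜) (hcard : A.card ≤ u.card) (hgt : ∀ t ∈ A \ u, ∀ w ∈ u, w < t) :
    ∃ B ∈ 𝒜, B ⊆ u ∧ B.card = A.card := by
  induction hr : (A \ u).card generalizing A with
  | zero =>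
    rw [Finset.card_eq_zero, Finset.sdiff_eq_empty_iff_subset] at hr
    exact ⟨A, hA, hr, rfl⟩
  | succ r ih =>
    have hne : (A \ u).Nonempty := by rw [← Finset.card_pos]; omega
    obtain ⟨hmA, hmu⟩ := Finset.mem_sdiff.1 ((A \ u).max'_mem hne)
    have hmgt := hgt _ ((A \ u).max'_mem hne)
    have hmax : ∀ x ∈ A, x ≤ (A \ u).max' hne := fun x hx => by
      by_cases hxu : x ∈ u
      · exact (hmgt x hxu).le
      · exact Finset.le_max' _ _ (Finset.mem_sdiff.2 ⟨hx, hxu⟩)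
    set m := (A \ u).max' hne
    obtain ⟨s, hsu, hsA⟩ : ∃ s ∈ u, s ∉ A := by
      by_contra! hcon
      exact hmu ((Finset.eq_of_subset_of_card_le hcon hcard) ▸ hmA)
    have hc : (insert s (A.erase m)).card = A.card := by
      rw [Finset.card_insert_of_notMem fun hs => hsA (Finset.mem_of_mem_erase hs),
        Finset.card_erase_add_one hmA]
    have hsd : insert s (A.erase m) \ u = (A \ u).erase m := by
      rw [Finset.insert_sdiff_of_mem _ hsu, Finset.erase_sdiff_comm]
    obtain ⟨B, hB, hBu, hBc⟩ := ih _ (h A hA m hmA hmax s (hmgt s hsu) hsA) (hc.trans_le hcard)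
      (fun t ht w hw => hgt t (by rw [hsd] at ht; exact Finset.mem_of_mem_erase ht) w hw)
      (by rw [hsd, Finset.card_erase_of_mem (Finset.mem_sdiff.2 ⟨hmA, hmu⟩), hr]; rfl)
    exact ⟨B, hB, hBu, hBc.trans hc⟩

/-- The order in which the generators are adjoined: by cardinality, then colexicographically. -/
def genOrder (A : Finset (Fin n)) : ℕ ×ₗ Colex (Finset (Fin n)) := toLex (A.card, toColex A)

theorem genOrder_injective : Function.Injective (genOrder (n := n)) := by
  intro A B h
  simpa [genOrder] using congrArg (fun p => (ofLex p).2) h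

theorem card_le_of_genOrder_lt {A B : Finset (Fin n)} (h : genOrder A < genOrder B) :
    A.card ≤ B.card := by
  rw [genOrder, genOrder, Prod.Lex.toLex_lt_toLex] at h
  rcases h with h | h
  · exact h.le
  · exact h.1.le

/-- Linear quotients: in the order `genOrder`, the colon ideal of the generators preceding `u` with
respect to `u` is generated by the variables indexed by the gaps of `u`. -/
theorem IsStable.colon_iff (h : IsStable 𝒜) {u : Finset (Fin n)}
    (hu : Minimal (· ∈ 𝒜) u) (M : Finset (Fin n)) :
    (∃ v, Minimal (· ∈ 𝒜) v ∧ genOrder v < genOrder u ∧ v ⊆ u ∪ M) ↔ ∃ t ∈ gaps u, t ∈ M := by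
  constructor
  · rintro ⟨v, hv, hlt, hvM⟩
    by_contra! hcon
    have hgt : ∀ t ∈ v \ u, ∀ w ∈ u, w < t := by
      intro t ht w hw
      obtain ⟨htv, htu⟩ := Finset.mem_sdiff.1 ht
      by_contra! hle
      refine hcon t (mem_gaps.2 ⟨htu, w, hw, lt_of_le_of_ne hle fun e => htu (e ▸ hw)⟩) ?_
      exact (Finset.mem_union.1 (hvM htv)).resolve_left htu
    have hle := card_le_of_genOrder_lt hlt
    obtain ⟨B, hB, hBu, hBc⟩ := h.exists_subset v hv.prop hle hgt
    rw [hu.eq_of_le hB hBu] at hBc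
    rw [genOrder, genOrder, Prod.Lex.toLex_lt_toLex] at hlt
    rcases hlt with hlt | ⟨-, hlt⟩
    · exact hlt.ne hBc.symm
    · obtain ⟨w, hw, hwv, hall⟩ := Finset.Colex.toColex_lt_toColex_iff_exists_forall_lt.1 hlt
      have hvu : v ⊆ u := fun x hx => by
        by_contra hxu
        exact absurd (hgt x (Finset.mem_sdiff.2 ⟨hx, hxu⟩) w hw) (not_lt.2 (hall x hx hxu).le)
      exact hwv (hu.eq_of_le hv.prop hvu ▸ hw)
  · rintro ⟨t, htg, htM⟩
    obtain ⟨htu, w, hw, htw⟩ := mem_gaps.1 htg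
    have hne : u.Nonempty := ⟨w, hw⟩
    have hmu := u.max'_mem hne
    have hmax : ∀ x ∈ u, x ≤ u.max' hne := fun x hx => u.le_max' x hx
    set m := u.max' hne
    have htm : t < m := htw.trans_le (hmax w hw)
    obtain ⟨v, hvs, hv⟩ := exists_minimal_subset (h u hu.prop m hmu hmax t htm htu)
    have hc : (insert t (u.erase m)).card = u.card := by
      rw [Finset.card_insert_of_notMem fun hs => htu (Finset.mem_of_mem_erase hs),
        Finset.card_erase_add_one hmu]
    refine ⟨v, hv, ?_, fun x hx => ?_⟩
    · rw [genOrder, genOrder, Prod.Lex.toLex_lt_toLex]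
      rcases (hc ▸ Finset.card_le_card hvs).lt_or_eq with hlt | heq
      · exact Or.inl hlt
      · refine Or.inr ⟨heq, ?_⟩
        refine Finset.Colex.toColex_lt_toColex_iff_exists_forall_lt.2 ⟨m, hmu, fun hmv => ?_, ?_⟩
        · rcases Finset.mem_insert.1 (hvs hmv) with e | e
          · exact htm.ne' e
          · exact Finset.notMem_erase m u e
        · intro x hx hxu
          rcases Finset.mem_insert.1 (hvs hx) with rfl | e
          · exact htm
          · exact absurd (Finset.mem_of_mem_erase e) hxu
    · rcases Finset.mem_insert.1 (hvs hx) with rfl | e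
      · exact Finset.mem_union_right _ htM
      · exact Finset.mem_union_left _ (Finset.mem_of_mem_erase e)

end Stable

/-! ### Squarefree monomial ideals -/

/-- The exponent of the squarefree monomial with support `A`. -/
noncomputable def sqExp (A : Finset (Fin n)) : Fin n →₀ ℕ := Finsupp.indicator A fun _ _ => 1

theorem sqExp_apply (A : Finset (Fin n)) (t : Fin n) : sqExp A t = if t ∈ A then 1 else 0 := by
  simp [sqExp, Finsupp.indicator_apply]

theorem support_sqExp (A : Finset (Fin n)) : (sqExp A).support = A := by
  ext t; simp [sqExp_apply]

theorem sqExp_injective : Function.Injective (sqExp (n := n)) := fun A B h => by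
  rw [← support_sqExp A, h, support_sqExp]

theorem sqExp_le_iff {A : Finset (Fin n)} {a : Fin n →₀ ℕ} : sqExp A ≤ a ↔ A ⊆ a.support := by
  constructor
  · intro h t ht
    have := h t
    rw [sqExp_apply, if_pos ht] at this
    rw [Finsupp.mem_support_iff]; omega
  · intro h t
    rw [sqExp_apply]
    split_ifs with ht
    · have := Finsupp.mem_support_iff.1 (h ht); omega
    · exact Nat.zero_le _

theorem sqExp_union {A B : Finset (Fin n)} (h : Disjoint A B) :
    sqExp (A ∪ B) = sqExp A + sqExp B := by
  ext t
  have : t ∈ A → t ∉ B := fun hA => Finset.disjoint_left.1 h hA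
  simp only [Finsupp.add_apply, sqExp_apply, Finset.mem_union]
  by_cases hA : t ∈ A <;> by_cases hB : t ∈ B <;> simp_all

theorem sqExp_empty : sqExp (∅ : Finset (Fin n)) = 0 := by
  ext t; simp [sqExp_apply]

theorem isSquarefreeExponent_sqExp (A : Finset (Fin n)) : IsSquarefreeExponent (sqExp A) := by
  intro t; rw [sqExp_apply]; split_ifs <;> simp

theorem IsSquarefreeExponent.eq_sqExp {a : Fin n →₀ ℕ} (h : IsSquarefreeExponent a) :
    a = sqExp a.support := by
  ext t
  have := h t
  rw [sqExp_apply]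
  split_ifs with ht
  · have := Finsupp.mem_support_iff.1 ht; omega
  · simpa using ht

theorem borelMove_sqExp {A : Finset (Fin n)} {j i : Fin n} (hj : j ∈ A) (hi : i ∉ A) :
    borelMove (sqExp A) j i = sqExp (insert i (A.erase j)) := by
  have hij : i ≠ j := fun e => hi (e ▸ hj)
  ext t
  simp only [borelMove, Finsupp.add_apply, Finsupp.tsub_apply, sqExp_apply, Finset.mem_insert,
    Finset.mem_erase, Finsupp.single_apply]
  by_cases h1 : t = i <;> by_cases h2 : t = j <;> by_cases h3 : t ∈ A <;> simp_all [eq_comm]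

variable (k) in
/-- The squarefree monomial ideal generated by the monomials with supports in `𝒢`. -/
noncomputable def sqIdeal (𝒢 : Set (Finset (Fin n))) : Ideal (MvPolynomial (Fin n) k) :=
  Ideal.span ((fun a => monomial a (1 : k)) '' (sqExp '' 𝒢))

theorem mem_sqIdeal {𝒢 : Set (Finset (Fin n))} {f : 𝕊} :
    f ∈ sqIdeal k 𝒢 ↔ ∀ m ∈ f.support, ∃ A ∈ 𝒢, A ⊆ m.support := by
  rw [sqIdeal, mem_ideal_span_monomial_image]
  simp only [Set.exists_mem_image, sqExp_le_iff]

theorem monomial_mem_sqIdeal {𝒢 : Set (Finset (Fin n))} {a : Fin n →₀ ℕ} :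
    monomial a (1 : k) ∈ sqIdeal k 𝒢 ↔ ∃ A ∈ 𝒢, A ⊆ a.support := by
  classical
  rw [mem_sqIdeal, support_monomial, if_neg one_ne_zero]
  simp

theorem sqIdeal_congr {𝒢 ℋ : Set (Finset (Fin n))}
    (h : ∀ B, (∃ A ∈ 𝒢, A ⊆ B) ↔ ∃ A ∈ ℋ, A ⊆ B) : sqIdeal k 𝒢 = sqIdeal k ℋ := by
  ext f
  simp only [mem_sqIdeal, h]

theorem sqIdeal_insert (u : Finset (Fin n)) (𝒢 : Set (Finset (Fin n))) :
    sqIdeal k (insert u 𝒢) = sqIdeal k 𝒢 ⊔ Ideal.span {monomial (sqExp u) 1} := by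
  rw [sqIdeal, Set.image_insert_eq, Set.image_insert_eq, Ideal.span_insert, sup_comm, sqIdeal]

/-- The colon ideal of a squarefree monomial ideal with respect to a squarefree monomial. -/
theorem mem_sqIdeal_iff_monomial_mul_mem {𝒢 𝒬 : Set (Finset (Fin n))} {u : Finset (Fin n)}
    (h : ∀ M, (∃ A ∈ 𝒬, A ⊆ M) ↔ ∃ A ∈ 𝒢, A ⊆ u ∪ M) (f : 𝕊) :
    f ∈ sqIdeal k 𝒬 ↔ monomial (sqExp u) 1 * f ∈ sqIdeal k 𝒢 := by
  simp only [mem_sqIdeal, mem_support_iff, h]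
  have hs : ∀ m : Fin n →₀ ℕ, (sqExp u + m).support = u ∪ m.support := fun m => by
    ext t
    by_cases ht : t ∈ u <;> simp [sqExp_apply, ht]
  constructor
  · intro hf m hm
    rw [coeff_monomial_mul'] at hm
    split_ifs at hm with hle
    · obtain ⟨A, hA, hAm⟩ := hf _ (right_ne_zero_of_mul hm)
      rw [← hs, add_tsub_cancel_of_le hle] at hAm
      exact ⟨A, hA, hAm⟩
    · exact absurd rfl hm
  · intro hf m hm
    rw [← hs]
    exact hf _ (by simpa [coeff_monomial_mul] using hm)

theorem sqIdeal_ne_top {𝒢 : Set (Finset (Fin n))} (h : ∅ ∉ 𝒢) : sqIdeal k 𝒢 ≠ ⊤ := by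
  rw [Ne, Ideal.eq_top_iff_one, ← C_1, ← monomial_zero', monomial_mem_sqIdeal]
  rintro ⟨A, hA, hA'⟩
  rw [Finsupp.support_zero, Finset.subset_empty] at hA'
  exact h (hA' ▸ hA)

/-! ### Resolutions of squarefree stable ideals -/

namespace QuotientResolution

theorem range_deg_zero {I : Ideal 𝕊} (F : QuotientResolution I) :
    Set.range (F.deg 0) = {0} := by
  ext a
  constructor
  · rintro ⟨b, rfl⟩
    rw [F.eq_root b, F.deg_root]; rfl
  · rintro rfl
    exact ⟨F.root, F.deg_root⟩

/-- The index sets of the resolution of `S = S/0`. -/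
abbrev botι : ℕ → Type
  | 0 => Unit
  | _ + 1 => Empty

/-- The resolution `0 → S` of `S = S/0`. -/
noncomputable def ofBot : QuotientResolution (⊥ : Ideal (MvPolynomial (Fin n) k)) where
  ι := botι
  finite
    | 0 => inferInstanceAs (Finite Unit)
    | _ + 1 => inferInstanceAs (Finite Empty)
  deg _ _ := 0
  d _ := 0
  graded _ b := isMultihomogeneous_zero _ _
  exact i x := iff_of_true rfl ⟨0, Finsupp.ext fun b : Empty => b.elim⟩
  root := ()
  eq_root _ := rfl
  deg_root := rfl
  mem_range f := by simp
  minimal _ := by simp [IsMinimalMap]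

theorem range_deg_ofBot (i : ℕ) :
    Set.range ((ofBot (k := k) (n := n)).deg (i + 1)) = ∅ := by
  have : IsEmpty ((ofBot (k := k) (n := n)).ι (i + 1)) := inferInstanceAs (IsEmpty Empty)
  exact Set.range_eq_empty _

end QuotientResolution

theorem sqIdeal_empty : sqIdeal k (∅ : Set (Finset (Fin n))) = ⊥ := by simp [sqIdeal]

theorem exists_singleton_subset_iff (q M : Finset (Fin n)) :
    (∃ A ∈ (fun s : Fin n => ({s} : Finset (Fin n))) '' q, A ⊆ M) ↔ ∃ t ∈ q, t ∈ M := by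
  simp

theorem range_deg_zero_eq_image {I : Ideal 𝕊} (F : QuotientResolution I) (q : Finset (Fin n)) :
    Set.range (F.deg 0) = sqExp '' {σ | σ ⊆ q ∧ σ.card = 0} := by
  have : {σ | σ ⊆ q ∧ σ.card = 0} = {∅} := by
    ext σ
    simp only [Finset.card_eq_zero, Set.mem_ofPred_eq, Set.mem_singleton_iff, and_iff_right_iff_imp]
    rintro rfl
    exact Finset.empty_subset q
  rw [F.range_deg_zero, this, Set.image_singleton, sqExp_empty]

/-- The Koszul resolution of the quotient by a set of variables, built up by adding one variable at
a time. -/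
theorem exists_koszul (q : Finset (Fin n)) :
    ∃ F : QuotientResolution (sqIdeal k ((fun s : Fin n => ({s} : Finset (Fin n))) '' q)),
      ∀ i, Set.range (F.deg i) = sqExp '' {σ | σ ⊆ q ∧ σ.card = i} := by
  induction q using Finset.induction_on with
  | empty =>
    rw [Finset.coe_empty, Set.image_empty, sqIdeal_empty]
    refine ⟨.ofBot, ?_⟩
    rintro (_ | i)
    · exact range_deg_zero_eq_image _ _
    · rw [QuotientResolution.range_deg_ofBot, eq_comm, Set.image_eq_empty,
        Set.eq_empty_iff_forall_notMem]
      rintro σ ⟨h1, h2⟩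
      rw [Finset.subset_empty.1 h1] at h2
      simp at h2
  | insert t q ht ih =>
    obtain ⟨F, hF⟩ := ih
    have hadd : ∀ σ ⊆ q, sqExp σ + sqExp {t} = sqExp (insert t σ) := fun σ hσ => by
      rw [Finset.insert_eq, Finset.union_comm, sqExp_union]
      exact Finset.disjoint_singleton_right.2 fun h => ht (hσ h)
    obtain ⟨F', hF'⟩ := F.exists_cone F (sqExp {t})
      (I' := sqIdeal k ((fun s : Fin n => ({s} : Finset (Fin n))) '' ↑(insert t q)))
      (mem_sqIdeal_iff_monomial_mul_mem fun M => by
        simp only [exists_singleton_subset_iff, Finset.mem_union, Finset.mem_singleton]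
        refine exists_congr fun s => and_congr_right fun hs => (or_iff_right ?_).symm
        rintro rfl; exact ht hs)
      (sqIdeal_ne_top (by simp)) (by rw [Finset.coe_insert, Set.image_insert_eq, sqIdeal_insert])
      (fun i b c h => by
        obtain ⟨σ, ⟨hσ, -⟩, hσb⟩ : F.deg (i + 1) b ∈ _ := hF (i + 1) ▸ Set.mem_range_self b
        obtain ⟨τ, ⟨hτ, -⟩, hτc⟩ : F.deg (i + 1) c ∈ _ := hF (i + 1) ▸ Set.mem_range_self c
        rw [← hσb, ← hτc, hadd τ hτ] at h
        exact ht (hσ (sqExp_injective h ▸ Finset.mem_insert_self t τ)))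
    refine ⟨F', ?_⟩
    rintro (_ | i)
    · exact range_deg_zero_eq_image _ _
    · rw [hF', hF, Set.range_comp' (· + sqExp {t}), hF, ← Set.image_comp]
      ext a
      constructor
      · rintro (⟨σ, ⟨hσ, hc⟩, rfl⟩ | ⟨σ, ⟨hσ, hc⟩, rfl⟩)
        · exact ⟨σ, ⟨hσ.trans (Finset.subset_insert t q), hc⟩, rfl⟩
        · refine ⟨insert t σ, ⟨Finset.insert_subset_insert t hσ, ?_⟩, (hadd σ hσ).symm⟩
          rw [Finset.card_insert_of_notMem fun h => ht (hσ h), hc]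
      · rintro ⟨σ, ⟨hσ, hc⟩, rfl⟩
        by_cases htσ : t ∈ σ
        · have hσ' : σ.erase t ⊆ q := by rwa [← Finset.subset_insert_iff]
          refine Or.inr ⟨σ.erase t, ⟨hσ', ?_⟩, ?_⟩
          · rw [Finset.card_erase_of_mem htσ, hc]; rfl
          · dsimp only [Function.comp_apply]
            rw [hadd _ hσ', Finset.insert_erase htσ]
        · exact Or.inl ⟨σ, ⟨(Finset.subset_insert_iff_of_notMem htσ).1 hσ, hc⟩, rfl⟩

/-- The minimal resolution of a squarefree stable ideal, an iterated mapping cone of Koszul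
resolutions along the generators ordered by `genOrder`. -/
theorem IsStable.exists_resolution {𝒜 : Set (Finset (Fin n))} (h : IsStable 𝒜) :
    ∃ F : QuotientResolution (sqIdeal k {u | Minimal (· ∈ 𝒜) u}),
      ∀ i, Set.range (F.deg (i + 1)) = sqExp '' shiftGens 𝒜 i := by
  classical
  -- The claim for all initial segments `s` of the set of generators.
  have key : ∀ s : Finset (Finset (Fin n)), (∀ u ∈ s, Minimal (· ∈ 𝒜) u) →
      (∀ u ∈ s, ∀ v, Minimal (· ∈ 𝒜) v → genOrder v < genOrder u → v ∈ s) →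
      ∃ F : QuotientResolution (sqIdeal k (s : Set (Finset (Fin n)))),
        ∀ i, Set.range (F.deg (i + 1)) =
          sqExp '' {D | ∃ u ∈ s, ∃ σ ⊆ gaps u, σ.card = i ∧ u ∪ σ = D} := by
    intro s
    induction s using Finset.induction_on_max_value genOrder with
    | empty =>
      intro _ _
      rw [Finset.coe_empty, sqIdeal_empty]
      exact ⟨.ofBot, fun i => by simp [QuotientResolution.range_deg_ofBot]⟩
    | insert u s hus hmax ih =>
      intro hmin hinit
      have hlt : ∀ v ∈ s, genOrder v < genOrder u := fun v hv =>
        lt_of_le_of_ne (hmax v hv) fun e => hus (genOrder_injective e ▸ hv)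
      obtain ⟨F, hF⟩ := ih (fun v hv => hmin v (Finset.mem_insert_of_mem hv)) fun v hv w hw hwv =>
        (Finset.mem_insert.1 (hinit v (Finset.mem_insert_of_mem hv) w hw hwv)).resolve_left
          fun e => lt_asymm (e ▸ hwv) (hlt v hv)
      have hu := hmin u (Finset.mem_insert_self u s)
      have hmem : ∀ v, v ∈ s ↔ Minimal (· ∈ 𝒜) v ∧ genOrder v < genOrder u := fun v =>
        ⟨fun hv => ⟨hmin v (Finset.mem_insert_of_mem hv), hlt v hv⟩, fun ⟨hv, hvu⟩ =>
          (Finset.mem_insert.1 (hinit u (Finset.mem_insert_self u s) v hv hvu)).resolve_left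
            fun e => hvu.ne (e ▸ rfl)⟩
      obtain ⟨K, hK⟩ := exists_koszul (k := k) (gaps u)
      have hdisj : ∀ v : Finset (Fin n), ∀ σ ⊆ gaps v, Disjoint σ v := fun v σ hσ =>
        Finset.disjoint_left.2 fun x hx => (mem_gaps.1 (hσ hx)).1
      obtain ⟨F', hF'⟩ := F.exists_cone K (sqExp u)
        (I' := sqIdeal k ((insert u s : Finset (Finset (Fin n))) : Set (Finset (Fin n))))
        (mem_sqIdeal_iff_monomial_mul_mem fun M => by
          rw [exists_singleton_subset_iff, ← h.colon_iff hu]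
          simp [hmem, and_assoc])
        (sqIdeal_ne_top (by simp)) (by rw [Finset.coe_insert, sqIdeal_insert])
        -- Equal multidegrees would give `|v| + i = |u| + i + 1`, but `|v| ≤ |u|`.
        (fun i b c he => by
          obtain ⟨_, ⟨v, hv, τ, hτ, hτc, rfl⟩, hb⟩ : F.deg (i + 1) b ∈ _ :=
            hF i ▸ Set.mem_range_self b
          obtain ⟨σ, ⟨hσ, hσc⟩, hc⟩ : K.deg (i + 1) c ∈ _ := hK (i + 1) ▸ Set.mem_range_self c
          rw [← hb, ← hc, ← sqExp_union (hdisj u σ hσ)] at he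
          have hcard := congrArg Finset.card (sqExp_injective he)
          rw [Finset.card_union_of_disjoint (hdisj u σ hσ),
            Finset.card_union_of_disjoint (hdisj v τ hτ).symm] at hcard
          have := card_le_of_genOrder_lt (hlt v hv)
          omega)
      refine ⟨F', fun i => ?_⟩
      rw [hF', hF, Set.range_comp' (· + sqExp u), hK, ← Set.image_comp]
      ext a
      constructor
      · rintro (⟨_, ⟨v, hv, σ, hσ, hc, rfl⟩, rfl⟩ | ⟨σ, ⟨hσ, hc⟩, rfl⟩)
        · exact ⟨_, ⟨v, Finset.mem_insert_of_mem hv, σ, hσ, hc, rfl⟩, rfl⟩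
        · refine ⟨_, ⟨u, Finset.mem_insert_self u s, σ, hσ, hc, rfl⟩, ?_⟩
          rw [Finset.union_comm, sqExp_union (hdisj u σ hσ)]; rfl
      · rintro ⟨_, ⟨v, hv, σ, hσ, hc, rfl⟩, rfl⟩
        rcases Finset.mem_insert.1 hv with rfl | hv
        · refine Or.inr ⟨σ, ⟨hσ, hc⟩, ?_⟩
          rw [Finset.union_comm, sqExp_union (hdisj v σ hσ)]; rfl
        · exact Or.inl ⟨_, ⟨v, hv, σ, hσ, hc, rfl⟩, rfl⟩
  obtain ⟨F, hF⟩ := key (Finset.univ.filter (Minimal (· ∈ 𝒜))) (by simp)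
    (fun u _ v hv _ => by simpa using hv)
  have hs : ((Finset.univ.filter (Minimal (· ∈ 𝒜)) : Finset (Finset (Fin n))) :
      Set (Finset (Fin n))) = {u | Minimal (· ∈ 𝒜) u} := by simp
  rw [← hs]
  exact ⟨F, fun i => (hF i).trans (by simp [shiftGens])⟩

/-! ### Homological shift ideals -/

theorem sqIdeal_minimal (𝒜 : Set (Finset (Fin n))) :
    sqIdeal k {u | Minimal (· ∈ 𝒜) u} = sqIdeal k 𝒜 := by
  refine sqIdeal_congr fun B => ⟨?_, ?_⟩
  · rintro ⟨u, hu, huB⟩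
    exact ⟨u, hu.prop, huB⟩
  · rintro ⟨A, hA, hAB⟩
    obtain ⟨u, huA, hu⟩ := exists_minimal_subset hA
    exact ⟨u, hu, huA.trans hAB⟩

/-- The homological shift ideals of a squarefree stable ideal in terms of gaps of generators. -/
theorem IsStable.HS_sqIdeal {𝒜 : Set (Finset (Fin n))} (h : IsStable 𝒜) (j : ℕ) :
    HS j (sqIdeal k 𝒜) = sqIdeal k (shiftUp 𝒜 j) := by
  obtain ⟨F, hF⟩ := h.exists_resolution (k := k)
  rw [← sqIdeal_minimal, HS_eq_span j F, hF]
  refine sqIdeal_congr fun B => ⟨?_, ?_⟩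
  · rintro ⟨D, hD, hDB⟩
    exact ⟨D, ⟨D, hD, subset_rfl⟩, hDB⟩
  · rintro ⟨A, ⟨D, hD, hDA⟩, hAB⟩
    exact ⟨D, hD, hDA.trans hAB⟩

/-- A squarefree Borel ideal is generated by the squarefree monomials it contains, and their
supports form a stable family. -/
theorem IsSquarefreeBorel.exists_isStable {I : Ideal 𝕊} (hI : IsSquarefreeBorel I) :
    ∃ 𝒜 : Set (Finset (Fin n)), IsStable 𝒜 ∧ I = sqIdeal k 𝒜 := by
  obtain ⟨⟨E, hE, hIE⟩, hB⟩ := hI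
  refine ⟨{A | monomial (sqExp A) (1 : k) ∈ I}, fun A hA m hm _ s hs hsA => ?_, ?_⟩
  · have := hB (sqExp A) m s hA (isSquarefreeExponent_sqExp A) (by simp [sqExp_apply, hm]) hs
    rw [borelMove_sqExp hm hsA] at this
    exact this (isSquarefreeExponent_sqExp _)
  · apply le_antisymm
    · conv_lhs => rw [hIE]
      refine Ideal.span_mono (Set.image_mono fun a ha => ⟨a.support, ?_, (hE a ha).eq_sqExp.symm⟩)
      rw [Set.mem_ofPred_eq, ← (hE a ha).eq_sqExp, hIE]
      exact Ideal.subset_span ⟨a, ha, rfl⟩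
    · refine Ideal.span_le.2 ?_
      rintro _ ⟨_, ⟨A, hA, rfl⟩, rfl⟩
      exact hA

end HomShift

theorem theorem1p9 {k : Type*} [Field k] {n : ℕ} (I : Ideal (MvPolynomial (Fin n) k))
    (hI : HomShift.IsSquarefreeBorel I) (i j : ℕ) :
    HomShift.HS (i + j) I = HomShift.HS i (HomShift.HS j I) := by
  obtain ⟨𝒜, h, rfl⟩ := hI.exists_isStable
  rw [h.HS_sqIdeal, h.HS_sqIdeal, (h.shift j).HS_sqIdeal, HomShift.shiftUp_shiftUp]
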